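/- Let $f:\mathbb{C}\to\mathbb{C}$ be a transcendental entire function, that is, a function holomorphic on all of $\mathbb{C}$ which is not a polynomial. Let the Fatou set $\mathcal{F}_f$ be the set of points $z\in\mathbb{C}$ having a connected open neighbourhood $U$ on which the iterates $\{f^{\circ n}\}_{n\ge 0}$ form a normal family, i.e. every sequence of iterates has a subsequence which either converges locally uniformly on $U$ to a holomorphic function or tends to $\infty$ uniformly on every compact subset of $U$. Let $\mathcal{J}_f=\mathbb{C}\setminus\mathcal{F}_f$ be the Julia set. Then $\mathcal{J}_f\neq\emptyset$. -/

import Mathlib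

open Filter

/-- A transcendental entire function: holomorphic on all of `ℂ` and not a polynomial function. -/
def IsTranscendentalEntire (f : ℂ → ℂ) : Prop :=
  Differentiable ℂ f ∧ ¬ ∃ p : Polynomial ℂ, ∀ z, f z = p.eval z

/-- Normality of a family `S` of holomorphic functions on a domain (connected open set) `U`: every
sequence in `S` has a subsequence which converges locally uniformly on `U` to a holomorphic
function, or which tends to `∞` uniformly on every compact subset of `U`. As `U` is connected, this
is the same as locally uniform subconvergence for the spherical metric. -/
def IsNormalFamilyOn (S : Set (ℂ → ℂ)) (U : Set ℂ) : Prop :=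
  ∀ u : ℕ → ℂ → ℂ, (∀ n, u n ∈ S) → ∃ φ : ℕ → ℕ, StrictMono φ ∧
    ((∃ g : ℂ → ℂ, DifferentiableOn ℂ g U ∧
        TendstoLocallyUniformlyOn (fun n => u (φ n)) g atTop U) ∨
      (∀ K ⊆ U, IsCompact K → ∀ M : ℝ, ∀ᶠ n in atTop, ∀ z ∈ K, M ≤ ‖u (φ n) z‖))

/-- The Fatou set: the points having a connected open neighbourhood on which the iterates of `f`
form a normal family. -/
def fatouSet (f : ℂ → ℂ) : Set ℂ :=
  {z | ∃ U : Set ℂ, IsOpen U ∧ IsConnected U ∧ z ∈ U ∧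
    IsNormalFamilyOn (Set.range fun n : ℕ => f^[n]) U}

/-- The Julia set: the complement of the Fatou set. -/
def juliaSet (f : ℂ → ℂ) : Set ℂ := (fatouSet f)ᶜ

/-!
If the Julia set is empty, the iterates of `f` are normal near every point. By an argument of Rosay,
`f ∘ f` has a fixed point `c`: otherwise little Picard makes `(f (f z) - z) / (f z - z)` a constant
`k ≠ 0, 1`, and differentiating shows that `f' ∘ f` omits `0` and `k`, so that `f` is affine. The
orbit of `c` is bounded, and normality propagates local boundedness of the iterates from `c` to the
whole plane. On the other hand `f` grows faster than linearly, so Schottky's theorem shows that the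
image of the disc of radius `R` contains a circle of radius at least `2 * R` once `R` is large, as
in Bohr's covering theorem. With the maximum principle, the iterates are then unbounded on a fixed
disc, a contradiction.

Schottky's and Picard's theorems are obtained by writing a function omitting `1` and `-1` as
`cos (π * cos g)`, where `cos g` omits the integers. The preimages of the integers under `cos` form
a net in the plane, so the image of `g` contains no large disc and Bloch's theorem bounds `g'`.
-/

open Metric Set Topology

theorem differentiableAt_of_comp_eventuallyEq {𝕜 : Type*} [NontriviallyNormedField 𝕜]
    [CompleteSpace 𝕜] {e f g : 𝕜 → 𝕜} {e' z : 𝕜} (he : HasStrictDerivAt e e' (g z))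
    (he' : e' ≠ 0) (hg : ContinuousAt g z) (hf : DifferentiableAt 𝕜 f z)
    (h : e ∘ g =ᶠ[𝓝 z] f) : DifferentiableAt 𝕜 g z := by
  have hinv : DifferentiableAt 𝕜 (he.localInverse e e' (g z) he') (f z) :=
    h.eq_of_nhds ▸ (he.to_localInverse he').hasDerivAt.differentiableAt
  refine (hinv.comp z hf).congr_of_eventuallyEq ?_
  filter_upwards [h, hg.eventually (he.eventually_left_inverse he')] with x hx hleft
  rw [Function.comp_apply, ← hx, Function.comp_apply, hleft]

theorem isSimplyConnected_of_convex {E : Type*} [AddCommGroup E] [Module ℝ E] [TopologicalSpace E]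
    [ContinuousAdd E] [ContinuousSMul ℝ E] {s : Set E} (hs : Convex ℝ s) (hne : s.Nonempty) :
    IsSimplyConnected s := by
  have := hs.contractibleSpace hne
  exact inferInstanceAs (SimplyConnectedSpace s)

theorem abs_im_le_norm_cos (w : ℂ) : |w.im| ≤ ‖Complex.cos w‖ := by
  have h := abs_norm_sub_norm_le (Complex.exp (-w * Complex.I)) (-Complex.exp (w * Complex.I))
  rw [sub_neg_eq_add, add_comm, ← Complex.two_cos, norm_neg, norm_mul, Complex.norm_exp,
    Complex.norm_exp, Complex.norm_two] at h
  calc |w.im| ≤ Real.sinh |w.im| := Real.self_le_sinh_iff.2 (abs_nonneg _)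
    _ = |Real.exp w.im - Real.exp (-w.im)| / 2 := by
      rw [← Real.abs_sinh, Real.sinh_eq, abs_div, abs_two]
    _ ≤ ‖Complex.cos w‖ := by
      simp only [neg_mul, Complex.neg_re, Complex.mul_I_re, neg_neg] at h
      linarith

theorem cos_pi_mul_intCast_eq_one_or_neg_one (n : ℤ) :
    Complex.cos (Real.pi * n) = 1 ∨ Complex.cos (Real.pi * n) = -1 := by
  rw [← Complex.sin_eq_zero_iff_cos_eq, mul_comm, Complex.sin_int_mul_pi]

section SimplyConnected

variable {U : Set ℂ} {f : ℂ → ℂ} {c : ℂ}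

theorem exists_differentiableOn_exp_eq (hUo : IsOpen U) (hUs : IsSimplyConnected U)
    (hf : DifferentiableOn ℂ f U) (h0 : ∀ z ∈ U, f z ≠ 0) (hc : c ∈ U) :
    ∃ g : ℂ → ℂ, DifferentiableOn ℂ g U ∧ (∀ z ∈ U, Complex.exp (g z) = f z) ∧
      g c = Complex.log (f c) := by
  obtain ⟨l, hl, hexp⟩ := Complex.exists_continuousOn_eqOn_exp_comp hUs hUo hf.continuousOn
    (by rintro ⟨z, hz, hfz⟩; exact h0 z hz hfz)
  have hld : DifferentiableOn ℂ l U := fun z hz =>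
    (differentiableAt_of_comp_eventuallyEq (Complex.hasStrictDerivAt_exp (l z))
      (Complex.exp_ne_zero _) (hl.continuousAt (hUo.mem_nhds hz))
      (hf.differentiableAt (hUo.mem_nhds hz))
      (hexp.eventuallyEq_of_mem (hUo.mem_nhds hz))).differentiableWithinAt
  obtain ⟨n, hn⟩ := Complex.exp_eq_exp_iff_exists_int.1
    ((Complex.exp_log (h0 c hc)).trans (hexp hc).symm)
  refine ⟨fun z => l z + n * (2 * Real.pi * Complex.I), hld.add_const _, fun z hz => ?_, hn.symm⟩
  exact (Complex.exp_periodic.int_mul n (l z)).trans (hexp hz)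

theorem exists_differentiableOn_cos_eq (hUo : IsOpen U) (hUs : IsSimplyConnected U)
    (hf : DifferentiableOn ℂ f U) (h1 : ∀ z ∈ U, f z ≠ 1) (h1' : ∀ z ∈ U, f z ≠ -1)
    (hc : c ∈ U) :
    ∃ g : ℂ → ℂ, DifferentiableOn ℂ g U ∧ (∀ z ∈ U, Complex.cos (g z) = f z) ∧
      ‖g c‖ ≤ ‖f c‖ + Real.pi := by
  obtain ⟨l, hl, hexp, -⟩ := exists_differentiableOn_exp_eq (f := fun z => f z ^ 2 - 1) hUo hUs
    ((hf.pow 2).sub_const 1)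
    (fun z hz h => (sq_eq_one_iff.1 (sub_eq_zero.1 h)).elim (h1 z hz) (h1' z hz)) hc
  -- With `s ^ 2 = f ^ 2 - 1`, a branch of the arccosine of `f` is `-i * log (f + s)`.
  set s : ℂ → ℂ := fun z => Complex.exp (l z / 2) with hs
  have hmul : ∀ z ∈ U, (f z + s z) * (f z - s z) = 1 := fun z hz => by
    have hsq : s z ^ 2 = f z ^ 2 - 1 := by
      rw [← hexp z hz, hs, ← Complex.exp_nat_mul, Nat.cast_two, mul_div_cancel₀ _ two_ne_zero]
    linear_combination -hsq
  obtain ⟨L, hL, hLexp, hLc⟩ := exists_differentiableOn_exp_eq (f := fun z => f z + s z) hUo hUs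
    (hf.add (hl.div_const 2).cexp) (fun z hz => left_ne_zero_of_mul_eq_one (hmul z hz)) hc
  have hcos : ∀ z ∈ U, Complex.cos (-Complex.I * L z) = f z := fun z hz => by
    have hLI : -Complex.I * L z * Complex.I = L z := by
      linear_combination -L z * Complex.I_mul_I
    rw [Complex.cos, neg_mul (-Complex.I * L z), hLI, Complex.exp_neg, hLexp z hz,
      ← eq_inv_of_mul_eq_one_right (hmul z hz)]
    ring
  refine ⟨fun z => -Complex.I * L z, hL.const_mul _, hcos, ?_⟩
  have him := abs_im_le_norm_cos (-Complex.I * L c)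
  have hre : (-Complex.I * L c).re = Complex.arg (f c + s c) := by simp [hLc, Complex.log_im]
  rw [hcos c hc] at him
  calc ‖-Complex.I * L c‖ ≤ |(-Complex.I * L c).re| + |(-Complex.I * L c).im| :=
        Complex.norm_le_abs_re_add_abs_im _
    _ ≤ ‖f c‖ + Real.pi := by
      rw [hre]
      linarith [Complex.abs_arg_le_pi (f c + s c)]

theorem exists_differentiableOn_cos_pi_mul_cos_eq (hUo : IsOpen U) (hUs : IsSimplyConnected U)
    (hf : DifferentiableOn ℂ f U) (h1 : ∀ z ∈ U, f z ≠ 1) (h1' : ∀ z ∈ U, f z ≠ -1)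
    (hc : c ∈ U) :
    ∃ g : ℂ → ℂ, DifferentiableOn ℂ g U ∧
      (∀ z ∈ U, Complex.cos (Real.pi * Complex.cos (g z)) = f z) ∧
      ‖g c‖ ≤ ‖f c‖ + 2 * Real.pi := by
  obtain ⟨F, hF, hFf, hFc⟩ := exists_differentiableOn_cos_eq hUo hUs hf h1 h1' hc
  have hpi : (Real.pi : ℂ) ≠ 0 := Complex.ofReal_ne_zero.2 Real.pi_ne_zero
  have hFpi : ∀ z ∈ U, ∀ n : ℤ, F z / Real.pi ≠ n := fun z hz n hn => by
    have hcos : Complex.cos (Real.pi * n) = f z := by rw [← hn, mul_div_cancel₀ _ hpi, hFf z hz]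
    exact (cos_pi_mul_intCast_eq_one_or_neg_one n).elim (fun h => h1 z hz (hcos ▸ h))
      fun h => h1' z hz (hcos ▸ h)
  obtain ⟨g, hg, hgF, hgc⟩ := exists_differentiableOn_cos_eq hUo hUs (hF.div_const Real.pi)
    (fun z hz => mod_cast hFpi z hz 1) (fun z hz => mod_cast hFpi z hz (-1)) hc
  refine ⟨g, hg, fun z hz => by rw [hgF z hz, mul_div_cancel₀ _ hpi, hFf z hz], ?_⟩
  have : ‖F c / Real.pi‖ ≤ ‖F c‖ := by
    rw [norm_div, Complex.norm_real, Real.norm_of_nonneg Real.pi_nonneg]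
    exact div_le_self (norm_nonneg _) (by linarith [Real.pi_gt_three])
  linarith

end SimplyConnected

theorem exists_cosh_eq_natCast_abs_sub_le (x : ℝ) :
    ∃ y : ℝ, |y - x| ≤ 2 ∧ ∃ n : ℕ, Real.cosh y = n := by
  wlog hx : 0 ≤ x generalizing x
  · obtain ⟨y, hy, n, hn⟩ := this (-x) (by linarith)
    exact ⟨-y, by rwa [neg_sub_left, abs_neg, add_comm, ← sub_neg_eq_add],
      n, by rw [Real.cosh_neg, hn]⟩
  have hcosh : Real.cosh x + 1 ≤ Real.cosh (x + 2) := by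
    have hcosh_two : 2 ≤ Real.cosh 2 := by
      have := Real.quadratic_le_exp_of_nonneg (x := 2) (by norm_num)
      rw [Real.cosh_eq]
      linarith [Real.exp_pos (-2)]
    have hsinh : 0 ≤ Real.sinh x * Real.sinh 2 :=
      mul_nonneg (Real.sinh_nonneg_iff.2 hx) (Real.sinh_nonneg_iff.2 zero_le_two)
    rw [Real.cosh_add]
    nlinarith [Real.one_le_cosh x]
  obtain ⟨y, ⟨hxy, hyx⟩, hy⟩ := intermediate_value_Icc (by linarith : x ≤ x + 2)
    Real.continuous_cosh.continuousOn
    ⟨Nat.le_ceil (Real.cosh x), (Nat.ceil_lt_add_one (Real.cosh_pos x).le).le.trans hcosh⟩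
  exact ⟨y, abs_le.2 ⟨by linarith, by linarith⟩, _, hy⟩

theorem exists_abs_sub_int_mul_two_pi_le_pi (x : ℝ) :
    ∃ m : ℤ, |x - m * (2 * Real.pi)| ≤ Real.pi := by
  have h := AddCircle.norm_le_half_period (2 * Real.pi) (x := (x : AddCircle (2 * Real.pi)))
    Real.two_pi_pos.ne'
  rw [AddCircle.norm_eq, abs_of_pos Real.two_pi_pos, mul_div_cancel_left₀ _ two_ne_zero] at h
  exact ⟨_, h⟩

theorem exists_cos_eq_natCast_norm_sub_lt (w : ℂ) :
    ∃ a : ℂ, ‖a - w‖ < 6 ∧ ∃ n : ℕ, Complex.cos a = n := by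
  obtain ⟨y, hy, n, hn⟩ := exists_cosh_eq_natCast_abs_sub_le w.im
  obtain ⟨m, hm⟩ := exists_abs_sub_int_mul_two_pi_le_pi w.re
  refine ⟨y * Complex.I + m * (2 * Real.pi), ?_, n, ?_⟩
  · have h := Complex.norm_le_abs_re_add_abs_im (y * Complex.I + m * (2 * Real.pi) - w)
    have hre : (y * Complex.I + m * (2 * Real.pi) - w).re = -(w.re - m * (2 * Real.pi)) := by simp
    have him : (y * Complex.I + m * (2 * Real.pi) - w).im = y - w.im := by simp
    rw [hre, him, abs_neg] at h
    linarith [Real.pi_lt_four]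
  · rw [Complex.cos_periodic.int_mul m, Complex.cos_mul_I]
    exact_mod_cast hn

theorem mul_norm_sub_le_norm_image_sub_of_norm_deriv_sub_le {𝕜 E : Type*} [RCLike 𝕜]
    [NormedAddCommGroup E] [NormedSpace 𝕜 E] {f : 𝕜 → E} {L : E} {ε : ℝ} {s : Set 𝕜}
    (hs : Convex ℝ s) (hf : ∀ x ∈ s, DifferentiableAt 𝕜 f x) (hd : ∀ x ∈ s, ‖deriv f x - L‖ ≤ ε)
    {x y : 𝕜} (hx : x ∈ s) (hy : y ∈ s) : (‖L‖ - ε) * ‖y - x‖ ≤ ‖f y - f x‖ := by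
  have hsub : ‖(f y - y • L) - (f x - x • L)‖ ≤ ε * ‖y - x‖ :=
    hs.norm_image_sub_le_of_norm_hasDerivWithin_le (f' := fun z => deriv f z - L)
      (fun z hz => by
        simpa using ((hf z hz).hasDerivAt.fun_sub
          ((hasDerivAt_id z).smul_const L)).hasDerivWithinAt) hd hx hy
  calc (‖L‖ - ε) * ‖y - x‖ ≤ ‖(y - x) • L‖ - ‖(f y - y • L) - (f x - x • L)‖ := by
        rw [norm_smul]
        linarith
    _ ≤ ‖(y - x) • L + ((f y - y • L) - (f x - x • L))‖ := norm_sub_le_norm_add _ _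
    _ = ‖f y - f x‖ := by
        rw [sub_smul]
        congr 1
        abel

section Bloch

variable {f : ℂ → ℂ} {a : ℂ} {r : ℝ}

theorem norm_deriv_sub_le_of_norm_deriv_le_two_mul (hr : 0 < r)
    (hf : DifferentiableOn ℂ f (ball a r)) (hb : ∀ z ∈ ball a r, ‖deriv f z‖ ≤ 2 * ‖deriv f a‖)
    {z : ℂ} (hz : z ∈ closedBall a (r / 6)) : ‖deriv f z - deriv f a‖ ≤ ‖deriv f a‖ / 2 := by
  have hmaps : MapsTo (deriv f) (ball a r) (closedBall (deriv f a) (3 * ‖deriv f a‖)) :=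
    fun w hw => by
      rw [mem_closedBall, dist_eq_norm]
      linarith [norm_sub_le (deriv f w) (deriv f a), hb w hw]
  have h := Complex.dist_le_div_mul_dist_of_mapsTo_ball (hf.deriv isOpen_ball) hmaps
    (closedBall_subset_ball (by linarith) hz)
  calc ‖deriv f z - deriv f a‖ ≤ 3 * ‖deriv f a‖ / r * dist z a := by rwa [← dist_eq_norm]
    _ ≤ 3 * ‖deriv f a‖ / r * (r / 6) := by gcongr; exact hz
    _ = ‖deriv f a‖ / 2 := by field_simp; ring

theorem ball_subset_image_ball_of_norm_deriv_le_two_mul (hr : 0 < r)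
    (hf : DifferentiableOn ℂ f (ball a r)) (hb : ∀ z ∈ ball a r, ‖deriv f z‖ ≤ 2 * ‖deriv f a‖) :
    ball (f a) (r * ‖deriv f a‖ / 24) ⊆ f '' ball a r := by
  rcases eq_or_ne (deriv f a) 0 with ha | ha
  · simp [ha]
  have hsub : closedBall a (r / 6) ⊆ ball a r := closedBall_subset_ball (by linarith)
  have hdiff : ∀ z ∈ ball a r, DifferentiableAt ℂ f z := fun z hz =>
    hf.differentiableAt (isOpen_ball.mem_nhds hz)
  have hsphere : ∀ z ∈ sphere a (r / 6), r * ‖deriv f a‖ / 12 ≤ ‖f z - f a‖ := fun z hz => by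
    have h := mul_norm_sub_le_norm_image_sub_of_norm_deriv_sub_le (convex_closedBall a (r / 6))
      (fun w hw => hdiff w (hsub hw))
      (fun w hw => norm_deriv_sub_le_of_norm_deriv_le_two_mul hr hf hb hw)
      (mem_closedBall_self (by positivity)) (sphere_subset_closedBall hz)
    rw [mem_sphere_iff_norm.1 hz] at h
    linarith
  have hne : ∃ᶠ z in 𝓝 a, f z ≠ f a :=
    ((hdiff a (mem_ball_self hr)).hasDerivAt.eventually_ne ha).frequently.filter_mono
      nhdsWithin_le_nhds
  have h := (hf.mono hsub).diffContOnCl_ball subset_rfl |>.ball_subset_image_closedBall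
    (by positivity) hsphere hne
  rw [div_div, show (12 : ℝ) * 2 = 24 by norm_num] at h
  exact h.trans (image_mono hsub)

theorem bloch_exists_ball_subset_image_ball (hr : 0 < r) (hf : DifferentiableOn ℂ f (ball a r)) :
    ∃ w, ball w (r * ‖deriv f a‖ / 96) ⊆ f '' ball a r := by
  have hsub : closedBall a (3 * r / 4) ⊆ ball a r := closedBall_subset_ball (by linarith)
  have hcont : Continuous fun z : closedBall a (3 * r / 4) => ‖deriv f z‖ :=
    (((hf.deriv isOpen_ball).continuousOn.mono hsub).domRestrict).norm
  have := (isClosed_closedBall (x := a) (ε := 3 * r / 4)).completeSpace_coe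
  -- Hofer's lemma moves `a` to a point `p` around which `‖deriv f‖` at most doubles.
  obtain ⟨s, hs, p, hsr, hpa, hmul, hp⟩ := hofer
    (⟨a, mem_closedBall_self (by positivity)⟩ : closedBall a (3 * r / 4)) (r / 4) (by positivity)
    hcont fun _ => norm_nonneg _
  rw [Subtype.dist_eq] at hpa
  have hps : ball (p : ℂ) s ⊆ closedBall a (3 * r / 4) := fun z hz => by
    rw [mem_closedBall]
    linarith [dist_triangle z p a, mem_ball.1 hz]
  have h := ball_subset_image_ball_of_norm_deriv_le_two_mul hs (hf.mono (hps.trans hsub))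
    fun z hz => hp ⟨z, hps hz⟩ (dist_comm z (p : ℂ) ▸ (mem_ball.1 hz).le)
  refine ⟨f p, (ball_subset_ball ?_).trans (h.trans (image_mono (hps.trans hsub)))⟩
  linarith

end Bloch

-- `576 = 6 * 96`: discs of radius `6` meet the net, and `96` comes from Bloch's theorem.
theorem norm_deriv_le_of_cos_ne_natCast {f : ℂ → ℂ} {a : ℂ} {r : ℝ} (hr : 0 < r)
    (hf : DifferentiableOn ℂ f (ball a r))
    (hcos : ∀ z ∈ ball a r, ∀ n : ℕ, Complex.cos (f z) ≠ n) : ‖deriv f a‖ ≤ 576 / r := by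
  obtain ⟨w, hw⟩ := bloch_exists_ball_subset_image_ball hr hf
  obtain ⟨v, hv, n, hn⟩ := exists_cos_eq_natCast_norm_sub_lt w
  have hv' : v ∉ f '' ball a r := by
    rintro ⟨z, hz, rfl⟩
    exact hcos z hz n hn
  have hle : r * ‖deriv f a‖ / 96 ≤ ‖v - w‖ := not_lt.1 fun h => hv' (hw (mem_ball_iff_norm.2 h))
  rw [le_div_iff₀ hr]
  linarith

theorem exists_norm_le_of_omits_one_neg_one (M : ℝ) :
    ∃ C : ℝ, ∀ (f : ℂ → ℂ) (c : ℂ) (r : ℝ), 0 < r → DifferentiableOn ℂ f (ball c r) →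
      (∀ z ∈ ball c r, f z ≠ 1) → (∀ z ∈ ball c r, f z ≠ -1) → ‖f c‖ ≤ M →
      ∀ z ∈ closedBall c (r / 2), ‖f z‖ ≤ C := by
  obtain ⟨C, hC⟩ := (isCompact_closedBall (0 : ℂ)
    (M + 2 * Real.pi + 576)).exists_bound_of_continuousOn
    (f := fun w => Complex.cos (Real.pi * Complex.cos w)) (by fun_prop)
  refine ⟨C, fun f c r hr hf h1 h1' hM z hz => ?_⟩
  have hcr : c ∈ closedBall c (r / 2) := mem_closedBall_self (by positivity)
  have hsub : closedBall c (r / 2) ⊆ ball c r := closedBall_subset_ball (by linarith)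
  obtain ⟨g, hg, hgf, hgc⟩ := exists_differentiableOn_cos_pi_mul_cos_eq isOpen_ball
    (isSimplyConnected_of_convex (convex_ball c r) ⟨c, mem_ball_self hr⟩) hf h1 h1' (hsub hcr)
  have hcos : ∀ w ∈ ball c r, ∀ n : ℕ, Complex.cos (g w) ≠ n := fun w hw n hn => by
    have hfw : Complex.cos (Real.pi * (n : ℤ)) = f w := by rw [← hgf w hw, hn, Int.cast_natCast]
    exact (cos_pi_mul_intCast_eq_one_or_neg_one n).elim (fun h => h1 w hw (hfw ▸ h))
      fun h => h1' w hw (hfw ▸ h)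
  have hderiv : ∀ w ∈ closedBall c (r / 2), ‖deriv g w‖ ≤ 576 / (r / 2) := fun w hw => by
    have hball : ball w (r / 2) ⊆ ball c r :=
      ball_subset_ball' (by linarith [mem_closedBall.1 hw])
    exact norm_deriv_le_of_cos_ne_natCast (half_pos hr) (hg.mono hball)
      fun v hv => hcos v (hball hv)
  have hgz : ‖g z - g c‖ ≤ 576 :=
    calc ‖g z - g c‖ ≤ 576 / (r / 2) * ‖z - c‖ :=
          (convex_closedBall c (r / 2)).norm_image_sub_le_of_norm_deriv_le
            (fun w hw => hg.differentiableAt (isOpen_ball.mem_nhds (hsub hw))) hderiv hcr hz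
      _ ≤ 576 / (r / 2) * (r / 2) := by gcongr; exact mem_closedBall_iff_norm.1 hz
      _ = 576 := div_mul_cancel₀ _ (half_pos hr).ne'
  rw [← hgf z (hsub hz)]
  refine hC (g z) (mem_closedBall_zero_iff.2 ?_)
  linarith [norm_sub_norm_le (g z) (g c)]

theorem schottky_norm_sub_le (M : ℝ) :
    ∃ C : ℝ, ∀ (f : ℂ → ℂ) (a b c : ℂ) (r : ℝ), a ≠ b → 0 < r → DifferentiableOn ℂ f (ball c r) →
      (∀ z ∈ ball c r, f z ≠ a) → (∀ z ∈ ball c r, f z ≠ b) → ‖f c - a‖ ≤ M * ‖b - a‖ →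
      ∀ z ∈ closedBall c (r / 2), ‖f z - a‖ ≤ C * ‖b - a‖ := by
  obtain ⟨C, hC⟩ := exists_norm_le_of_omits_one_neg_one (2 * M + 1)
  refine ⟨(C + 1) / 2, fun f a b c r hab hr hf ha hb hM z hz => ?_⟩
  have hba : b - a ≠ 0 := sub_ne_zero.2 hab.symm
  have hpos : 0 < ‖b - a‖ := norm_pos_iff.2 hba
  set g : ℂ → ℂ := fun w => 2 * ((f w - a) / (b - a)) - 1 with hg
  have hfg (w : ℂ) : f w = a + (g w + 1) / 2 * (b - a) := by
    simp only [hg]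
    field_simp
    ring
  have hgc : ‖g c‖ ≤ 2 * M + 1 := by
    have h := norm_sub_le (2 * ((f c - a) / (b - a))) 1
    rw [norm_mul, norm_div, norm_one, Complex.norm_two] at h
    linarith [(div_le_iff₀ hpos).2 hM]
  have hgz : ‖g z‖ ≤ C :=
    hC g c r hr (((hf.sub_const a).div_const _).const_mul 2 |>.sub_const 1)
      (fun w hw h => hb w hw (by rw [hfg, h]; ring))
      (fun w hw h => ha w hw (by rw [hfg, h]; ring)) hgc z hz
  rw [hfg z, add_sub_cancel_left, norm_mul, norm_div, Complex.norm_two]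
  gcongr
  exact norm_add_le_of_le hgz norm_one.le

theorem little_picard {f : ℂ → ℂ} (hf : Differentiable ℂ f) {a b : ℂ} (hab : a ≠ b)
    (ha : ∀ z, f z ≠ a) (hb : ∀ z, f z ≠ b) : ∃ c, ∀ z, f z = c := by
  have hpos : 0 < ‖b - a‖ := norm_sub_pos_iff.2 hab.symm
  obtain ⟨C, hC⟩ := schottky_norm_sub_le (‖f 0 - a‖ / ‖b - a‖)
  refine hf.exists_const_forall_eq_of_bounded
    (isBounded_iff_forall_norm_le.2 ⟨C * ‖b - a‖ + ‖a‖, forall_mem_range.2 fun z => ?_⟩)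
  have h := hC f a b 0 (2 * (‖z‖ + 1)) hab (by positivity) hf.differentiableOn (fun w _ => ha w)
    (fun w _ => hb w) (div_mul_cancel₀ _ hpos.ne').ge z (by simp)
  linarith [norm_sub_norm_le (f z) a]

theorem eq_mul_add_of_deriv_eq {𝕜 : Type*} [RCLike 𝕜] {f : 𝕜 → 𝕜} (hf : Differentiable 𝕜 f)
    {a : 𝕜} (ha : ∀ x, deriv f x = a) (x : 𝕜) : f x = a * x + f 0 := by
  have key : ∀ y, HasDerivAt (fun y => f y - a * y) 0 y := fun y => by
    simpa [ha y] using (hf y).hasDerivAt.fun_sub ((hasDerivAt_id y).const_mul a)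
  have h := is_const_of_deriv_eq_zero (fun y => (key y).differentiableAt)
    (fun y => (key y).deriv) x 0
  simp only [mul_zero, sub_zero] at h
  rw [← h, add_sub_cancel]

section Entire

variable {f : ℂ → ℂ}

theorem exists_eq_mul_add_of_apply_apply_sub_eq_mul {k : ℂ} (hf : Differentiable ℂ f) (hk0 : k ≠ 0)
    (hk1 : k ≠ 1) (hfk : ∀ z, f (f z) - z = k * (f z - z)) : ∃ a b, ∀ z, f z = a * z + b := by
  have hderiv : ∀ z, deriv f z * (deriv f (f z) - k) = 1 - k := fun z => by
    have hl : HasDerivAt (fun z => f (f z) - z) (deriv f (f z) * deriv f z - 1) z :=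
      ((hf (f z)).hasDerivAt.comp z (hf z).hasDerivAt).fun_sub (hasDerivAt_id z)
    have hr : HasDerivAt (fun z => k * (f z - z)) (k * (deriv f z - 1)) z :=
      ((hf z).hasDerivAt.fun_sub (hasDerivAt_id z)).const_mul k
    rw [funext hfk] at hl
    linear_combination hl.unique hr
  have hne (z : ℂ) : deriv f z * (deriv f (f z) - k) ≠ 0 := by
    rw [hderiv]
    exact sub_ne_zero.2 hk1.symm
  obtain ⟨d, hd⟩ := little_picard (hf.deriv.comp hf) hk0.symm
    (fun z => left_ne_zero_of_mul (hne (f z))) fun z => sub_ne_zero.1 (right_ne_zero_of_mul (hne z))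
  have hdk : d - k ≠ 0 := by
    rw [← hd 0]
    exact right_ne_zero_of_mul (hne 0)
  refine ⟨_, _, eq_mul_add_of_deriv_eq hf (a := (1 - k) / (d - k)) fun z => ?_⟩
  rw [eq_div_iff hdk, ← hd z]
  exact hderiv z

theorem exists_apply_apply_sub_eq_mul (hf : Differentiable ℂ f) (hfix : ∀ z, f (f z) ≠ z) :
    ∃ k, k ≠ 0 ∧ k ≠ 1 ∧ ∀ z, f (f z) - z = k * (f z - z) := by
  have hfz (z : ℂ) : f z - z ≠ 0 := fun h => by
    have hz := sub_eq_zero.1 h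
    exact hfix z (by rw [hz, hz])
  have hne0 (z : ℂ) : (f (f z) - z) / (f z - z) ≠ 0 := div_ne_zero (sub_ne_zero.2 (hfix z)) (hfz z)
  have hne1 (z : ℂ) : (f (f z) - z) / (f z - z) ≠ 1 := fun h =>
    hfz (f z) (by linear_combination (div_eq_one_iff_eq (hfz z)).1 h)
  obtain ⟨k, hk⟩ := little_picard
    (((hf.comp hf).sub differentiable_id).div (hf.sub differentiable_id) hfz) zero_ne_one hne0 hne1
  exact ⟨k, hk 0 ▸ hne0 0, hk 0 ▸ hne1 0, fun z => (div_eq_iff (hfz z)).1 (hk z)⟩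

theorem exists_apply_apply_eq_self (hf : Differentiable ℂ f)
    (hf' : ¬ ∃ a b : ℂ, ∀ z, f z = a * z + b) : ∃ c, f (f c) = c := by
  by_contra! hfix
  obtain ⟨k, hk0, hk1, hk⟩ := exists_apply_apply_sub_eq_mul hf hfix
  exact hf' (exists_eq_mul_add_of_apply_apply_sub_eq_mul hf hk0 hk1 hk)

end Entire

theorem exists_sphere_subset_image_ball :
    ∃ C : ℝ, ∀ (f : ℂ → ℂ) (c : ℂ) (r ρ : ℝ), 0 < r → 0 < ρ → DifferentiableOn ℂ f (ball c r) →
      ‖f c‖ ≤ ρ → (∃ z ∈ closedBall c (r / 2), C * ρ < ‖f z‖) →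
      ∃ s ≥ ρ, sphere 0 s ⊆ f '' ball c r := by
  obtain ⟨C, hC⟩ := schottky_norm_sub_le 2
  refine ⟨3 * |C| + 1, fun f c r ρ hr hρ hf hc ⟨z, hz, hfz⟩ => ?_⟩
  by_contra! hmiss
  obtain ⟨a, ha, haf⟩ := not_subset.1 (hmiss ρ le_rfl)
  obtain ⟨b, hb, hbf⟩ := not_subset.1 (hmiss (2 * ρ) (by linarith))
  rw [mem_sphere_zero_iff_norm] at ha hb
  have hle : ρ ≤ ‖b - a‖ := by linarith [norm_sub_norm_le b a]
  have hge : ‖b - a‖ ≤ 3 * ρ := by linarith [norm_sub_le b a]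
  have hab : a ≠ b := (norm_sub_pos_iff.1 (hρ.trans_le hle)).symm
  have hfza : ‖f z - a‖ ≤ C * ‖b - a‖ := hC f a b c r hab hr hf
    (fun w hw h => haf ⟨w, hw, h⟩) (fun w hw h => hbf ⟨w, hw, h⟩)
    (by linarith [norm_sub_le (f c) a]) z hz
  have hCba : C * ‖b - a‖ ≤ |C| * (3 * ρ) := by gcongr; exact le_abs_self C
  linarith [norm_sub_norm_le (f z) a]

theorem exists_mem_sphere_forall_norm_le {E : Type*} [NormedAddCommGroup E] [NormedSpace ℂ E]
    {g : ℂ → E} {c : ℂ} {s : ℝ} (hs : 0 < s) (hg : DiffContOnCl ℂ g (ball c s)) :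
    ∃ w ∈ sphere c s, ∀ z ∈ closedBall c s, ‖g z‖ ≤ ‖g w‖ := by
  obtain ⟨w, hw, hmax⟩ :=
    Complex.exists_mem_frontier_isMaxOn_norm isBounded_ball ⟨c, mem_ball_self hs⟩ hg
  rw [frontier_ball c hs.ne'] at hw
  rw [closure_ball c hs.ne'] at hmax
  exact ⟨w, hw, hmax⟩

section Growth

variable {f : ℂ → ℂ}

theorem exists_eq_mul_add_of_frequently_norm_le {C : ℝ} (hf : Differentiable ℂ f)
    (hC : ∃ᶠ R : ℝ in atTop, ∀ z ∈ closedBall (0 : ℂ) R, ‖f z‖ ≤ C * R) :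
    ∃ a b, ∀ z, f z = a * z + b := by
  have hderiv (z : ℂ) : ‖deriv f z‖ ≤ 2 * C := by
    obtain ⟨R, hR, hzR⟩ := (hC.and_eventually (eventually_ge_atTop (2 * (‖z‖ + 1)))).exists
    have hRpos : 0 < R / 2 := by linarith [norm_nonneg z]
    have hsub : sphere z (R / 2) ⊆ closedBall 0 R :=
      sphere_subset_closedBall.trans (closedBall_subset_closedBall' (by
        rw [dist_zero_right]
        linarith))
    calc ‖deriv f z‖ ≤ C * R / (R / 2) :=
          Complex.norm_deriv_le_of_forall_mem_sphere_norm_le hRpos hf.diffContOnCl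
            fun w hw => hR w (hsub hw)
      _ = 2 * C := by
          rw [div_div_eq_mul_div, div_eq_iff (by linarith)]
          ring
  obtain ⟨a, ha⟩ := hf.deriv.exists_const_forall_eq_of_bounded
    (isBounded_iff_forall_norm_le.2 ⟨2 * C, forall_mem_range.2 hderiv⟩)
  exact ⟨a, f 0, eq_mul_add_of_deriv_eq hf ha⟩

theorem exists_forall_ge_exists_sphere_subset_image (hf : Differentiable ℂ f)
    (hf' : ¬ ∃ a b : ℂ, ∀ z, f z = a * z + b) :
    ∃ R₀ > 0, ∀ R ≥ R₀, ∃ s ≥ 2 * R, sphere 0 s ⊆ f '' closedBall 0 R := by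
  obtain ⟨C, hC⟩ := exists_sphere_subset_image_ball
  have hgrowth : ∀ᶠ R : ℝ in atTop, ∃ z ∈ closedBall (0 : ℂ) R, 4 * C * R < ‖f z‖ := by
    by_contra! h
    exact hf' (exists_eq_mul_add_of_frequently_norm_le hf (by simpa [not_eventually] using h))
  obtain ⟨R₁, hR₁⟩ := eventually_atTop.1 hgrowth
  refine ⟨max (2 * R₁) (‖f 0‖ + 1), by positivity, fun R hR => ?_⟩
  rw [ge_iff_le, max_le_iff] at hR
  have hRpos : 0 < R := by linarith [norm_nonneg (f 0)]
  obtain ⟨z, hz, hfz⟩ := hR₁ (R / 2) (by linarith)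
  obtain ⟨s, hs, hsf⟩ := hC f 0 R (2 * R) hRpos (by positivity) hf.differentiableOn (by linarith)
    ⟨z, hz, by linarith⟩
  exact ⟨s, hs, hsf.trans (image_mono ball_subset_closedBall)⟩

theorem exists_two_pow_mul_le_norm_iterate {R₀ : ℝ} (hf : Differentiable ℂ f) (hR₀ : 0 < R₀)
    (h : ∀ R ≥ R₀, ∃ s ≥ 2 * R, sphere 0 s ⊆ f '' closedBall 0 R) (n : ℕ) :
    ∀ R ≥ R₀, ∃ z ∈ closedBall (0 : ℂ) R, 2 ^ n * R ≤ ‖f^[n] z‖ := by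
  induction n with
  | zero =>
    intro R hR
    have hRabs : |R| = R := abs_of_nonneg (hR₀.le.trans hR)
    exact ⟨R, by simp [hRabs], by simp [hRabs]⟩
  | succ n ih =>
    intro R hR
    obtain ⟨s, hs, hsf⟩ := h R hR
    obtain ⟨z, hz, hzn⟩ := ih s (by linarith)
    obtain ⟨w, hw, hmax⟩ := exists_mem_sphere_forall_norm_le (by linarith : 0 < s)
      (hf.iterate n).diffContOnCl
    obtain ⟨x, hx, rfl⟩ := hsf hw
    refine ⟨x, hx, ?_⟩
    calc 2 ^ (n + 1) * R = 2 ^ n * (2 * R) := by ring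
      _ ≤ 2 ^ n * s := by gcongr
      _ ≤ ‖f^[n] z‖ := hzn
      _ ≤ ‖f^[n + 1] x‖ := hmax z hz

end Growth

section LocallyBounded

variable {X E : Type*} [TopologicalSpace X] [Norm E] {S : Set (X → E)}

/-- The points having a neighbourhood on which the family `S` is uniformly bounded. Where `S` is
normal this set is both open and closed, so that boundedness spreads from a single point. -/
def locallyBoundedSet (S : Set (X → E)) : Set X :=
  {x | ∃ M : ℝ, ∀ᶠ y in 𝓝 x, ∀ g ∈ S, ‖g y‖ ≤ M}

theorem isOpen_locallyBoundedSet : IsOpen (locallyBoundedSet S) :=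
  isOpen_iff_mem_nhds.2 fun _ ⟨M, hM⟩ => hM.eventually_nhds.mono fun _ hy => ⟨M, hy⟩

theorem exists_norm_le_of_subset_locallyBoundedSet {K : Set X} (hK : IsCompact K)
    (hKS : K ⊆ locallyBoundedSet S) : ∃ M : ℝ, ∀ x ∈ K, ∀ g ∈ S, ‖g x‖ ≤ M := by
  refine hK.induction_on (p := fun t => ∃ M : ℝ, ∀ x ∈ t, ∀ g ∈ S, ‖g x‖ ≤ M) ⟨0, by simp⟩
    (fun s t hst ⟨M, hM⟩ => ⟨M, fun x hx => hM x (hst hx)⟩) ?_ fun x hx => ?_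
  · rintro s t ⟨M, hM⟩ ⟨N, hN⟩
    exact ⟨max M N, fun x hx g hg => hx.elim (fun h => (hM x h g hg).trans (le_max_left _ _))
      fun h => (hN x h g hg).trans (le_max_right _ _)⟩
  · obtain ⟨M, hM⟩ := hKS hx
    exact ⟨_, mem_nhdsWithin_of_mem_nhds hM, M, fun y hy => hy⟩

end LocallyBounded

theorem IsNormalFamilyOn.mem_locallyBoundedSet {S : Set (ℂ → ℂ)} {U : Set ℂ} {z w : ℂ} {B : ℝ}
    (hS : IsNormalFamilyOn S U) (hU : IsOpen U) (hz : z ∈ U) (hw : w ∈ U)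
    (hB : ∀ g ∈ S, ‖g w‖ ≤ B) : z ∈ locallyBoundedSet S := by
  obtain ⟨V, hV⟩ := (𝓝 z).exists_antitone_basis
  by_contra hzS
  have hex (k : ℕ) : ∃ x ∈ V k, ∃ g ∈ S, (k : ℝ) < ‖g x‖ := by
    by_contra! h
    exact hzS ⟨k, mem_of_superset (hV.mem k) h⟩
  choose x hx u huS hux using hex
  have hxz : Tendsto x atTop (𝓝 z) := hV.tendsto hx
  obtain ⟨φ, hφ, ⟨g, hg, hlim⟩ | hinf⟩ := hS u huS
  · have hxφ : Tendsto (x ∘ φ) atTop (𝓝 z) := hxz.comp hφ.tendsto_atTop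
    have hconv : Tendsto (fun k => u (φ k) (x (φ k))) atTop (𝓝 (g z)) :=
      hlim.tendsto_comp (hg.continuousOn z hz) hz
        (tendsto_nhdsWithin_iff.2 ⟨hxφ, hxφ.eventually (hU.mem_nhds hz)⟩)
    have htop : Tendsto (fun k => ‖u (φ k) (x (φ k))‖) atTop atTop :=
      tendsto_atTop_mono (fun k => (hux (φ k)).le)
        (tendsto_natCast_atTop_atTop.comp hφ.tendsto_atTop)
    exact not_tendsto_nhds_of_tendsto_atTop htop _ hconv.norm
  · obtain ⟨k, hk⟩ := (hinf {w} (singleton_subset_iff.2 hw) isCompact_singleton (B + 1)).exists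
    linarith [hk w rfl, hB (u (φ k)) (huS (φ k))]

theorem locallyBoundedSet_eq_univ {S : Set (ℂ → ℂ)} {c : ℂ} {B : ℝ}
    (hS : ∀ z, ∃ U, IsOpen U ∧ z ∈ U ∧ IsNormalFamilyOn S U) (hB : ∀ g ∈ S, ‖g c‖ ≤ B) :
    locallyBoundedSet S = univ := by
  have hclosed : IsClosed (locallyBoundedSet S) := by
    refine closure_subset_iff_isClosed.1 fun z hz => ?_
    obtain ⟨U, hU, hzU, hSU⟩ := hS z
    obtain ⟨w, hwU, M, hM⟩ := mem_closure_iff.1 hz U hU hzU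
    exact hSU.mem_locallyBoundedSet hU hzU hwU hM.self_of_nhds
  obtain ⟨U, hU, hcU, hSU⟩ := hS c
  exact IsClopen.eq_univ ⟨hclosed, isOpen_locallyBoundedSet⟩
    ⟨c, hSU.mem_locallyBoundedSet hU hcU hcU hB⟩

theorem norm_iterate_le_max_of_apply_apply_eq {E : Type*} [Norm E] {f : E → E} {c : E}
    (hc : f (f c) = c) (n : ℕ) : ‖f^[n] c‖ ≤ max ‖c‖ ‖f c‖ := by
  have hper : Function.IsPeriodicPt f 2 c := hc
  rw [← hper.iterate_mod_apply n]
  rcases Nat.mod_two_eq_zero_or_one n with h | h <;> simp [h]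

theorem mainTheorem1_general {f : ℂ → ℂ} (hf : Differentiable ℂ f)
    (hf' : ¬ ∃ a b : ℂ, ∀ z, f z = a * z + b) : (juliaSet f).Nonempty := by
  by_contra hJ
  have hF (z : ℂ) : z ∈ fatouSet f := by
    rw [not_nonempty_iff_eq_empty, juliaSet, compl_empty_iff] at hJ
    exact hJ ▸ mem_univ z
  obtain ⟨c, hc⟩ := exists_apply_apply_eq_self hf hf'
  have hbdd : locallyBoundedSet (range fun n : ℕ => f^[n]) = univ :=
    locallyBoundedSet_eq_univ (fun z => let ⟨U, hU, _, hzU, hN⟩ := hF z; ⟨U, hU, hzU, hN⟩)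
      (forall_mem_range.2 (norm_iterate_le_max_of_apply_apply_eq hc))
  obtain ⟨R, hR, hcover⟩ := exists_forall_ge_exists_sphere_subset_image hf hf'
  obtain ⟨M, hM⟩ := exists_norm_le_of_subset_locallyBoundedSet
    (isCompact_closedBall (0 : ℂ) R) (hbdd ▸ subset_univ _)
  obtain ⟨n, hn⟩ := pow_unbounded_of_one_lt (M / R) one_lt_two
  obtain ⟨z, hz, hzn⟩ := exists_two_pow_mul_le_norm_iterate hf hR hcover n R le_rfl
  rw [div_lt_iff₀ hR] at hn
  linarith [hM z hz _ (mem_range_self n)]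

theorem mainTheorem1 (f : ℂ → ℂ) (hf : IsTranscendentalEntire f) :
    (juliaSet f).Nonempty :=
  mainTheorem1_general hf.1 fun ⟨a, b, h⟩ =>
    hf.2 ⟨Polynomial.C a * Polynomial.X + Polynomial.C b, by simpa using h⟩
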